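/- All spaces are Tychonoff. For a compact space $K$, let $C_p(K)$ be the space of continuous functions $K\to\mathbb{R}$ with the topology of pointwise convergence. A space is Eberlein–Grothendieck if it is homeomorphic to a subspace of $C_p(K)$ for some compact space $K$, and an Eberlein compactum is a compact Eberlein–Grothendieck space. A space $X$ is Čech-complete if it is a $G_\delta$ subset of its Stone–Čech compactification $\beta X$, scattered if every nonempty subspace of it has an isolated point, and $\sigma$-discrete if it is the union of countably many discrete subspaces. Let $\mathcal{S}$ be the family of all singletons of a space $X$. In the game $\mathcal{G}(\mathcal{S},X)$, at move $n\in\omega$ Player I chooses $C_n\in\mathcal{S}$ and then Player II chooses an open set $U_n\supseteq C_n$; Player I wins the play if $X=\bigcup_{n\in\omega}U_n$, and otherwise Player II wins. **Corollary 4.4.** Let $X$ be an Eberlein–Grothendieck Čech-complete space such that Player I has a winning strategy in $\mathcal{G}(\mathcal{S},X)$. Then $X$ is $\sigma$-compact and $\sigma$-discrete. Moreover, $X=\bigcup_{n\in\omega}K_n$ where each $K_n$ is a subspace of $X$ that is a scattered Eberlein compactum and is $\sigma$-discrete. -/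

import Mathlib

universe u

open Set Topology

/-- `C_p(K)`: the continuous real-valued functions on `K`, with the topology inherited from the
product space `ℝ ^ K` (the instance is the subspace topology). -/
abbrev Cp (K : Type u) [TopologicalSpace K] : Type u := {f : K → ℝ // Continuous f}

/-- `X` is Eberlein-Grothendieck: it is homeomorphic to a subspace of `C_p(K)` for some compact
Hausdorff space `K`. Taking `K` in the universe of `X` is no restriction: if `X` is a subspace of
`C_p(K)` for any compact `K`, it also embeds in `C_p(L)`, where `L` is the image of `K` in `ℝ ^ X`
under the evaluation map. -/
def IsEberleinGrothendieck (X : Type u) [TopologicalSpace X] : Prop :=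
  ∃ (K : Type u) (_ : TopologicalSpace K) (_ : CompactSpace K) (_ : T2Space K) (e : X → Cp K),
    IsEmbedding e

/-- Eberlein compact: a compact space homeomorphic to a subspace of `C_p(K)` for some compact
Hausdorff space `K`. -/
def IsEberleinCompact (X : Type u) [TopologicalSpace X] : Prop :=
  CompactSpace X ∧ IsEberleinGrothendieck X

/-- Čech-complete: Tychonoff, and a `G_δ` subset of the Stone-Čech compactification. -/
def IsCechComplete (X : Type u) [TopologicalSpace X] : Prop :=
  T35Space X ∧ IsGδ (range (stoneCechUnit : X → StoneCech X))

/-- Scattered: every nonempty subspace has an isolated point. -/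
def IsScattered (X : Type u) [TopologicalSpace X] : Prop :=
  ∀ A : Set X, A.Nonempty → ∃ x ∈ A, ∃ U : Set X, IsOpen U ∧ U ∩ A = {x}

/-- `σ`-discrete: a countable union of discrete subspaces. -/
def IsSigmaDiscrete (X : Type u) [TopologicalSpace X] : Prop :=
  ∃ D : ℕ → Set X, (∀ n, IsDiscrete (D n)) ∧ ⋃ n, D n = univ

namespace CoverGame

/-- A rule for Player I in the game `G(C, Y)`: a set `t n (U_0, …, U_{n-1})` for every finite
sequence of sets. Only the values at legal sequences matter. -/
abbrev Rule (Y : Type u) : Type u := (n : ℕ) → (Fin n → Set Y) → Set Y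

variable {Y : Type u} [TopologicalSpace Y]

/-- `(U_0, …, U_{n-1})` is legal for `t`: each `U_i` is open and contains
`t(U_0, …, U_{i-1})`. -/
def IsLegal (t : Rule Y) (n : ℕ) (U : Fin n → Set Y) : Prop :=
  ∀ i : Fin n, IsOpen (U i) ∧ t i (fun j : Fin i => U (j.castLE i.isLt.le)) ⊆ U i

/-- `t` is a strategy for Player I in `G(C, Y)`: it answers every legal sequence by a member of
`C`. -/
def IsStrategy (C : Set (Set Y)) (t : Rule Y) : Prop :=
  ∀ (n : ℕ) (U : Fin n → Set Y), IsLegal t n U → t n U ∈ C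

/-- `t` is a winning strategy for Player I in `G(C, Y)`: in every infinite play in which Player I
uses `t`, the open sets chosen by Player II cover `Y`. -/
def IsWinningStrategy (C : Set (Set Y)) (t : Rule Y) : Prop :=
  IsStrategy C t ∧
    ∀ U : ℕ → Set Y, (∀ n, IsOpen (U n) ∧ t n (fun i : Fin n => U i) ⊆ U n) → ⋃ n, U n = univ

/-- Player I has a winning strategy in `G(C, Y)`. -/
def PlayerIWins (C : Set (Set Y)) : Prop :=
  ∃ t : Rule Y, IsWinningStrategy C t

end CoverGame

/-- The family of all singletons of `X`. -/
def singletons (X : Type u) : Set (Set X) := range (fun x : X => ({x} : Set X))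

/-! ### Games -/

/-! The games give the compact cover. In a Čech-complete space each point lies in a compact set `⋂
k, O x k` with every `O x k` open. If Player II answers only by sets `O x k`, finite plays are coded
by finite lists of naturals, so Player I names only countably many points. Were some `z` outside all
the compact sets at these points, Player II could avoid `z` forever. Also `X` is scattered: in a set
without isolated points, Player II can shrink open sets of `βX` away from Player I's points and into
the `G n`; the limit is a point of `X` never covered.

What remains is that a scattered Eberlein compactum is `σ`-discrete. The main step is
`hasSmallPieces_univ`: for each `ε`, a compact set of functions in `C_p(K)` is a countable union of
pieces of locally small uniform diameter. As with projectional resolutions, the pairing `φ x k` is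
exhausted by a continuous chain of retractions onto smaller subpairs, with induction on cardinality;
each `x` changes by a fixed amount at only finitely many stages, so finitely many integers locally
determine the stage to use. In a scattered space, `IsScattered.exists_antisymm_nhds` then turns
pieces that are small enough into discrete ones. -/

/-- The sequence in which every term is computed by `Φ` from the preceding ones. -/
def recSeq {α : Type*} (Φ : (n : ℕ) → (Fin n → α) → α) (n : ℕ) : α :=
  Φ n (fun i => recSeq Φ i)
termination_by n
decreasing_by exact i.isLt

theorem recSeq_eq {α : Type*} (Φ : (n : ℕ) → (Fin n → α) → α) (n : ℕ) :
    recSeq Φ n = Φ n (fun i => recSeq Φ i) := by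
  rw [recSeq]

namespace CoverGame

variable {X : Type u} [TopologicalSpace X]

/-- If Player I uses a winning strategy with singletons and Player II always answers by an open set
containing the chosen point, then the answers cover the space. -/
theorem iUnion_eq_univ_of_forall_mem {t : Rule X} (ht : IsWinningStrategy (singletons X) t)
    {pt : (n : ℕ) → (Fin n → Set X) → X}
    (hpt : ∀ n H, t n H ∈ singletons X → t n H = {pt n H}) {U : ℕ → Set X}
    (hU : ∀ n, IsOpen (U n) ∧ pt n (fun i : Fin n => U i) ∈ U n) : ⋃ n, U n = univ := by
  have key : ∀ n, t n (fun i : Fin n => U i) ⊆ U n := by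
    intro n
    induction n using Nat.strong_induction_on with
    | _ n ih =>
      have hleg : IsLegal t n (fun i : Fin n => U i) := fun i => ⟨(hU i).1, ih i i.isLt⟩
      rw [hpt n _ (ht.1 n _ hleg)]
      exact singleton_subset_iff.2 (hU n).2
  exact ht.2 U fun n => ⟨(hU n).1, key n⟩

-- Making the point total, with arbitrary values at illegal sequences, lets plays be defined by
-- recursion before their legality is known.
omit [TopologicalSpace X] in
theorem exists_point_choice [Nonempty X] (t : Rule X) :
    ∃ pt : (n : ℕ) → (Fin n → Set X) → X,
      ∀ n H, t n H ∈ singletons X → t n H = {pt n H} := by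
  have : ∀ n H, ∃ x : X, t n H ∈ singletons X → t n H = {x} := by
    intro n H
    by_cases h : t n H ∈ singletons X
    · obtain ⟨x, hx⟩ := h
      exact ⟨x, fun _ => hx.symm⟩
    · exact ⟨Classical.arbitrary X, fun h' => absurd h' h⟩
  choose pt hpt using this
  exact ⟨pt, hpt⟩

theorem PlayerIWins.nonempty (h : PlayerIWins (singletons X)) : Nonempty X := by
  obtain ⟨t, ht⟩ := h
  obtain ⟨x, -⟩ := ht.1 0 Fin.elim0 (fun i => i.elim0)
  exact ⟨x⟩

/-- If every point `x` is contained in the intersection of a sequence `O x` of open sets and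
Player I wins the point-open game, then countably many of these intersections cover the space. -/
theorem PlayerIWins.exists_countable_cover (h : PlayerIWins (singletons X))
    {O : X → ℕ → Set X} (hO : ∀ x k, IsOpen (O x k) ∧ x ∈ O x k) :
    ∃ p : ℕ → X, ⋃ n, ⋂ k, O (p n) k = univ := by
  have := h.nonempty
  obtain ⟨t, ht⟩ := h
  obtain ⟨pt, hpt⟩ := exists_point_choice t
  let play : (ℕ → ℕ) → ℕ → Set X := fun σ => recSeq fun n H => O (pt n H) (σ n)
  have play_eq : ∀ σ n, play σ n = O (pt n fun i : Fin n => play σ i) (σ n) :=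
    fun σ n => recSeq_eq _ n
  -- The point named by Player I after the answers coded by `l`; the padding value `0` is never
  -- consulted.
  let q : List ℕ → X := fun l => pt l.length fun i => play (fun j => l.getD j 0) i
  suffices hq : ⋃ l, ⋂ k, O (q l) k = univ by
    obtain ⟨e, he⟩ := exists_surjective_nat (List ℕ)
    refine ⟨q ∘ e, ?_⟩
    rw [← hq]
    exact he.iUnion_comp fun l => ⋂ k, O (q l) k
  by_contra hne
  obtain ⟨z, hz⟩ := (ne_univ_iff_exists_notMem _).1 hne
  have hz' : ∀ x, ∃ k, x ∈ range q → z ∉ O x k := by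
    intro x
    by_cases hx : x ∈ range q
    · obtain ⟨l, rfl⟩ := hx
      simp only [mem_iUnion, mem_iInter, not_exists, not_forall] at hz
      obtain ⟨k, hk⟩ := hz l
      exact ⟨k, fun _ => hk⟩
    · exact ⟨0, fun h => absurd h hx⟩
  -- Player II's way of avoiding `z`: at each reachable point, an index whose open set omits `z`.
  choose k hk using hz'
  let U : ℕ → Set X := recSeq fun n H => O (pt n H) (k (pt n H))
  have U_eq : ∀ n, U n = O (pt n fun i : Fin n => U i) (k (pt n fun i : Fin n => U i)) :=
    fun n => recSeq_eq _ n
  let σ : ℕ → ℕ := fun n => k (pt n fun i : Fin n => U i)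
  have agree : ∀ (τ : ℕ → ℕ) (N : ℕ), (∀ i < N, τ i = σ i) → ∀ n < N, play τ n = U n := by
    intro τ N hτ n
    induction n using Nat.strong_induction_on with
    | _ n ih =>
      intro hn
      have : (fun i : Fin n => play τ i) = fun i : Fin n => U i :=
        funext fun i => ih i i.isLt (i.isLt.trans hn)
      rw [play_eq, U_eq, this, hτ n hn]
  have hmem : ∀ n, pt n (fun i : Fin n => U i) ∈ range q := by
    intro n
    refine ⟨(List.range n).map σ, ?_⟩
    have hlen : ((List.range n).map σ).length = n := by simp
    have h1 : ∀ i < n, ((List.range n).map σ).getD i 0 = σ i := by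
      intro i hi
      simp [List.getD, hi]
    have h2 := agree _ n h1
    have h3 : ∀ m, m = n → pt m (fun i : Fin m =>
        play (fun j => ((List.range n).map σ).getD j 0) i) = pt n (fun i : Fin n => U i) := by
      rintro m rfl
      congr 1
      exact funext fun i => h2 i i.isLt
    exact h3 _ hlen
  have hcov := iUnion_eq_univ_of_forall_mem ht hpt (U := U) fun n => by
    refine ⟨?_, ?_⟩
    · rw [U_eq]; exact (hO _ _).1
    · exact (U_eq n).ge (hO _ _).2
  obtain ⟨n, hn⟩ := mem_iUnion.1 (hcov ▸ mem_univ z : z ∈ ⋃ n, U n)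
  rw [U_eq] at hn
  exact hk _ (hmem n) hn

end CoverGame

/-! ### Čech-complete spaces -/

section CechComplete

variable {X : Type u} [TopologicalSpace X]

theorem IsCechComplete.exists_isOpen (h : IsCechComplete X) :
    ∃ G : ℕ → Set (StoneCech X), (∀ n, IsOpen (G n)) ∧
      range (stoneCechUnit : X → StoneCech X) = ⋂ n, G n :=
  isGδ_iff_eq_iInter_nat.1 h.2

/-- In a Čech-complete space every point lies in a compact `G_δ` set. -/
theorem IsCechComplete.exists_isCompact_iInter (h : IsCechComplete X) (x : X) :
    ∃ O : ℕ → Set X, (∀ k, IsOpen (O k) ∧ x ∈ O k) ∧ IsCompact (⋂ k, O k) := by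
  have := h.1
  obtain ⟨G, hGo, hG⟩ := h.exists_isOpen
  have hemb : IsEmbedding (stoneCechUnit : X → StoneCech X) :=
    isDenseEmbedding_stoneCechUnit.isEmbedding
  have hxG : ∀ n, stoneCechUnit x ∈ G n := fun n =>
    mem_iInter.1 (hG ▸ mem_range_self x) n
  have hf : ∀ n, ∃ f : C(StoneCech X, ℝ), f (stoneCechUnit x) = 0 ∧ ∀ z ∉ G n, f z = 1 := by
    intro n
    obtain ⟨f, hf0, hf1, -⟩ := exists_continuous_zero_one_of_isClosed
      (isClosed_singleton (x := stoneCechUnit x)) (hGo n).isClosed_compl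
      (disjoint_singleton_left.2 fun hx => hx (hxG n))
    exact ⟨f, hf0 rfl, fun z hz => hf1 hz⟩
  choose f hf0 hf1 using hf
  let C : Set (StoneCech X) := ⋂ n, {z | f n z = 0}
  have hC : IsCompact C :=
    (isClosed_iInter fun n => isClosed_eq (f n).continuous continuous_const).isCompact
  have hCr : C ⊆ range (stoneCechUnit : X → StoneCech X) := by
    intro z hz
    rw [hG]
    refine mem_iInter.2 fun n => by_contra fun hn => ?_
    have h0 : f n z = 0 := mem_iInter.1 hz n
    rw [hf1 n z hn] at h0
    exact one_ne_zero h0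
  refine ⟨fun k => {y | |f k.unpair.1 (stoneCechUnit y)| < 1 / ((k.unpair.2 : ℝ) + 1)},
    fun k => ⟨?_, ?_⟩, ?_⟩
  · exact isOpen_lt ((f _).continuous.comp continuous_stoneCechUnit).abs continuous_const
  · simp only [mem_ofPred_eq, hf0, abs_zero]
    positivity
  · have : (⋂ k : ℕ, {y : X | |f k.unpair.1 (stoneCechUnit y)| < 1 / ((k.unpair.2 : ℝ) + 1)}) =
        stoneCechUnit ⁻¹' C := by
      ext y
      simp only [mem_iInter, mem_ofPred_eq, mem_preimage, C]
      constructor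
      · intro hy n
        by_contra hne
        obtain ⟨m, hm⟩ := exists_nat_one_div_lt (abs_pos.2 hne)
        have := hy (Nat.pair n m)
        simp only [Nat.unpair_pair] at this
        exact lt_asymm this hm
      · intro hy k
        rw [hy, abs_zero]
        positivity
    rw [this]
    exact (hemb.isInducing.isCompact_preimage_iff hCr).2 hC

/-- A Čech-complete space in which Player I wins the point-open game is scattered. -/
theorem IsCechComplete.isScattered (h : IsCechComplete X)
    (hI : CoverGame.PlayerIWins (singletons X)) : IsScattered X := by
  have := h.1
  have := hI.nonempty
  obtain ⟨G, hGo, hG⟩ := h.exists_isOpen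
  obtain ⟨t, ht⟩ := hI
  obtain ⟨pt, hpt⟩ := CoverGame.exists_point_choice t
  have hemb : IsEmbedding (stoneCechUnit : X → StoneCech X) :=
    isDenseEmbedding_stoneCechUnit.isEmbedding
  intro A hA
  by_contra hiso
  push Not at hiso
  -- One shrinking step in `βX`. As no point of `A` is isolated, `W` contains a point of `A` other
  -- than `x`; regularity gives a smaller open set around it.
  have hpick : ∀ (n : ℕ) (W : Set (StoneCech X)) (x : X), ∃ W' : Set (StoneCech X),
      IsOpen W → (∃ a ∈ A, stoneCechUnit a ∈ W) →
        IsOpen W' ∧ (∃ a ∈ A, stoneCechUnit a ∈ W') ∧ closure W' ⊆ W ∧ closure W' ⊆ G n ∧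
          stoneCechUnit x ∉ closure W' := by
    intro n W x
    by_cases hW : IsOpen W ∧ ∃ a ∈ A, stoneCechUnit a ∈ W
    swap
    · exact ⟨∅, fun h1 h2 => absurd ⟨h1, h2⟩ hW⟩
    obtain ⟨hWo, a, haA, haW⟩ := hW
    obtain ⟨b, hbA, hbW, hbx⟩ : ∃ b ∈ A, stoneCechUnit b ∈ W ∧ b ≠ x := by
      by_cases hax : a = x
      · by_contra hno
        push Not at hno
        refine hiso a haA _ (hWo.preimage continuous_stoneCechUnit) ?_
        refine Subset.antisymm (fun b hb => ?_) (singleton_subset_iff.2 ⟨haW, haA⟩)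
        rw [mem_singleton_iff, hax]
        exact hno b hb.2 hb.1
      · exact ⟨a, haA, haW, hax⟩
    have hopen : IsOpen (W ∩ G n ∩ {stoneCechUnit x}ᶜ) :=
      (hWo.inter (hGo n)).inter isOpen_compl_singleton
    have hbmem : stoneCechUnit b ∈ W ∩ G n ∩ {stoneCechUnit x}ᶜ :=
      ⟨⟨hbW, mem_iInter.1 (hG ▸ mem_range_self b) n⟩, fun hb => hbx (hemb.injective hb)⟩
    obtain ⟨F, ⟨hF, hFc⟩, hFsub⟩ := (closed_nhds_basis _).mem_iff.1 (hopen.mem_nhds hbmem)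
    have hcl : closure (interior F) ⊆ W ∩ G n ∩ {stoneCechUnit x}ᶜ :=
      (closure_minimal interior_subset hFc).trans hFsub
    exact ⟨interior F, fun _ _ => ⟨isOpen_interior, ⟨b, hbA, mem_interior_iff_mem_nhds.2 hF⟩,
      fun z hz => (hcl hz).1.1, fun z hz => (hcl hz).1.2, fun hz => (hcl hz).2 rfl⟩⟩
  choose pick hpick using hpick
  let U : Set (StoneCech X) → Set X := fun W => stoneCechUnit ⁻¹' (closure W)ᶜ
  let prev : (n : ℕ) → (Fin n → Set (StoneCech X)) → Set (StoneCech X) := fun n H =>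
    match n, H with
    | 0, _ => univ
    | m + 1, H => H (Fin.last m)
  let W : ℕ → Set (StoneCech X) :=
    recSeq fun n H => pick n (prev n H) (pt n fun i => U (H i))
  have W_eq : ∀ n, W n = pick n (prev n fun i : Fin n => W i) (pt n fun i : Fin n => U (W i)) :=
    fun n => recSeq_eq _ n
  have hgood : ∀ n, IsOpen (W n) ∧ ∃ a ∈ A, stoneCechUnit a ∈ W n := by
    intro n
    induction n with
    | zero =>
      obtain ⟨a, ha⟩ := hA
      have := hpick 0 univ (pt 0 fun i : Fin 0 => U (W i)) isOpen_univ ⟨a, ha, mem_univ _⟩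
      rw [W_eq]
      exact ⟨this.1, this.2.1⟩
    | succ n ih =>
      have := hpick (n + 1) (W n) (pt (n + 1) fun i : Fin (n + 1) => U (W i)) ih.1 ih.2
      rw [W_eq]
      exact ⟨this.1, this.2.1⟩
  have hprev : ∀ n, IsOpen (prev n fun i : Fin n => W i) ∧
      ∃ a ∈ A, stoneCechUnit a ∈ prev n fun i : Fin n => W i := by
    rintro (_ | n)
    · obtain ⟨a, ha⟩ := hA
      exact ⟨isOpen_univ, a, ha, mem_univ _⟩
    · exact hgood n
  have hW : ∀ n, closure (W n) ⊆ (prev n fun i : Fin n => W i) ∧ closure (W n) ⊆ G n ∧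
      stoneCechUnit (pt n fun i : Fin n => U (W i)) ∉ closure (W n) := by
    intro n
    have := hpick n _ (pt n fun i : Fin n => U (W i)) (hprev n).1 (hprev n).2
    rw [← W_eq] at this
    exact this.2.2
  have hcov := CoverGame.iUnion_eq_univ_of_forall_mem ht hpt (U := fun n => U (W n))
    fun n => ⟨isClosed_closure.isOpen_compl.preimage continuous_stoneCechUnit, (hW n).2.2⟩
  obtain ⟨z, hz⟩ := IsCompact.nonempty_iInter_of_sequence_nonempty_isCompact_isClosed
    (fun n => closure (W n)) (fun n => ((hW (n + 1)).1).trans subset_closure)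
    (fun n => by
      obtain ⟨a, -, ha⟩ := (hgood n).2
      exact ⟨_, subset_closure ha⟩)
    isClosed_closure.isCompact (fun n => isClosed_closure)
  have hzr : z ∈ range (stoneCechUnit : X → StoneCech X) := by
    rw [hG]
    exact mem_iInter.2 fun n => (hW n).2.1 (mem_iInter.1 hz n)
  obtain ⟨y, rfl⟩ := hzr
  obtain ⟨n, hn⟩ := mem_iUnion.1 (hcov ▸ mem_univ y : y ∈ ⋃ n, U (W n))
  exact hn (mem_iInter.1 hz n)

end CechComplete

/-! ### Scattered spaces -/

section Scattered

variable {X : Type u} [TopologicalSpace X]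

theorem IsScattered.subtype (h : IsScattered X) (S : Set X) : IsScattered S := by
  intro A hA
  obtain ⟨x, ⟨a, haA, rfl⟩, U, hU, hUA⟩ := h (Subtype.val '' A) (hA.image _)
  refine ⟨a, haA, Subtype.val ⁻¹' U, hU.preimage continuous_subtype_val, ?_⟩
  have : a.1 ∈ U ∩ Subtype.val '' A := hUA ▸ mem_singleton _
  refine Subset.antisymm (fun b hb => ?_) (singleton_subset_iff.2 ⟨this.1, haA⟩)
  have hb' : b.1 ∈ U ∩ Subtype.val '' A := ⟨hb.1, b, hb.2, rfl⟩
  rw [hUA] at hb'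
  exact Subtype.ext hb'

/-- The points of Cantor-Bendixson rank less than `α`. -/
def belowRank (X : Type u) [TopologicalSpace X] (α : Ordinal.{u}) : Set X :=
  {x | ∃ (β : Ordinal.{u}) (_ : β < α), ∃ U : Set X, IsOpen U ∧ x ∈ U ∧
    ∀ y ∈ U, y ≠ x → y ∈ belowRank X β}
termination_by α

theorem mem_belowRank {α : Ordinal.{u}} {x : X} : x ∈ belowRank X α ↔
    ∃ β < α, ∃ U : Set X, IsOpen U ∧ x ∈ U ∧ ∀ y ∈ U, y ≠ x → y ∈ belowRank X β := by
  rw [belowRank]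
  simp

theorem belowRank_mono {α β : Ordinal.{u}} (h : α ≤ β) : belowRank X α ⊆ belowRank X β := by
  intro x hx
  obtain ⟨γ, hγ, hU⟩ := mem_belowRank.1 hx
  exact mem_belowRank.2 ⟨γ, hγ.trans_le h, hU⟩

/-- In a scattered space there are neighborhoods `U x` of the points such that distinct `x`, `y`
never satisfy both `x ∈ U y` and `y ∈ U x`. -/
theorem IsScattered.exists_antisymm_nhds (h : IsScattered X) :
    ∃ U : X → Set X, (∀ x, U x ∈ 𝓝 x) ∧ ∀ x y, x ∈ U y → y ∈ U x → x = y := by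
  have hall : ∀ x : X, ∃ α, x ∈ belowRank X α := by
    by_contra hne
    push Not at hne
    obtain ⟨x, hx, U, hU, hUA⟩ := h {x : X | ∀ α, x ∉ belowRank X α} hne
    have hr : ∀ y : X, ∃ α, y ∈ U → y ≠ x → y ∈ belowRank X α := by
      intro y
      by_cases hy : y ∈ U ∧ y ≠ x
      · by_contra hno
        push Not at hno
        have : y ∈ U ∩ {x : X | ∀ α, x ∉ belowRank X α} := ⟨hy.1, fun α => (hno α).2.2⟩
        rw [hUA] at this
        exact hy.2 this
      · exact ⟨0, fun h1 h2 => absurd ⟨h1, h2⟩ hy⟩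
    choose r hr using hr
    have hxU : x ∈ U ∩ {x : X | ∀ α, x ∉ belowRank X α} := hUA ▸ mem_singleton x
    -- All other points of `U` have a rank, so `x` would have one as well.
    refine hx (Order.succ (⨆ y, r y)) (mem_belowRank.2 ⟨⨆ y, r y, Order.lt_succ _, U, hU, hxU.1,
      fun y hy hyx => belowRank_mono (Ordinal.le_iSup r y) (hr y hy hyx)⟩)
  have hmin : ∀ x : X, ∃ β : Ordinal.{u}, x ∉ belowRank X β ∧ ∃ U : Set X, IsOpen U ∧ x ∈ U ∧
      ∀ y ∈ U, y ≠ x → y ∈ belowRank X β := by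
    intro x
    let α := sInf {α | x ∈ belowRank X α}
    have hα : x ∈ belowRank X α := csInf_mem (s := {α | x ∈ belowRank X α}) (hall x)
    obtain ⟨β, hβ, hU⟩ := mem_belowRank.1 hα
    exact ⟨β, fun hxβ => notMem_of_lt_csInf' hβ hxβ, hU⟩
  choose β hβ U hUo hxU hU using hmin
  refine ⟨U, fun x => (hUo x).mem_nhds (hxU x), fun x y hxy hyx => by_contra fun hne => ?_⟩
  -- Every point of `U x` other than `x` has rank below that of `x`, so mutual membership would make
  -- one of the two ranks too small.
  rcases le_total (β x) (β y) with hle | hle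
  · exact hβ y (belowRank_mono hle (hU x y hyx (Ne.symm hne)))
  · exact hβ x (belowRank_mono hle (hU y x hxy hne))

end Scattered

/-! ### Separately continuous pairings of compact spaces -/

/-- A set `B` of parameters is approximated at finitely many points of `A`: every `k` is close, at
the points of any finite subset of `A`, to an element of `B`. -/
def ApproxOn {X K : Type*} (φ : X → K → ℝ) (A : Set X) (B : Set K) : Prop :=
  ∀ k, ∀ F : Set X, F.Finite → F ⊆ A → ∀ ε > 0, ∃ b ∈ B, ∀ a ∈ F, |φ a b - φ a k| < ε

/-- Approximation gives the closed conditions at points of `A` the finite intersection property on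
the compact set `closure B`; equality on `A` then passes to `closure A` by continuity in `x`. -/
theorem ApproxOn.exists_eq {X K : Type*} [TopologicalSpace X] [TopologicalSpace K] [CompactSpace K]
    {φ : X → K → ℝ} (hX : ∀ k, Continuous fun x => φ x k) (hK : ∀ x, Continuous (φ x))
    {A : Set X} {B : Set K} (h : ApproxOn φ A B) (k : K) :
    ∃ k' ∈ closure B, ∀ x ∈ closure A, φ x k' = φ x k := by
  let t : A × ℕ → Set K := fun p => {k' | |φ p.1 k' - φ p.1 k| ≤ 1 / ((p.2 : ℝ) + 1)}
  have hcl : ∀ p, IsClosed (t p) := fun p =>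
    isClosed_le ((hK _).sub continuous_const).abs continuous_const
  obtain ⟨k', hk', hk't⟩ := isClosed_closure.isCompact.inter_iInter_nonempty t hcl
    (s := closure B) fun u => by
      obtain ⟨n, hn⟩ : ∃ n : ℕ, ∀ p ∈ u, p.2 ≤ n :=
        ⟨u.sup Prod.snd, fun p hp => Finset.le_sup (f := Prod.snd) hp⟩
      obtain ⟨b, hb, hbu⟩ := h k ((fun p : A × ℕ => p.1.1) '' (u : Set (A × ℕ)))
        (u.finite_toSet.image _) (by rintro _ ⟨p, -, rfl⟩; exact p.1.2) (1 / ((n : ℝ) + 1))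
        (by positivity)
      refine ⟨b, subset_closure hb, mem_iInter₂.2 fun p hp => ?_⟩
      refine (hbu _ ⟨p, hp, rfl⟩).le.trans ?_
      have : (p.2 : ℝ) ≤ n := by exact_mod_cast hn p hp
      exact one_div_le_one_div_of_le (by positivity) (by linarith)
  refine ⟨k', hk', fun x hx => ?_⟩
  have hA : A ⊆ {x | φ x k' = φ x k} := by
    intro a ha
    by_contra hne
    obtain ⟨m, hm⟩ := exists_nat_one_div_lt (abs_pos.2 (sub_ne_zero.2 hne))
    exact absurd (mem_iInter.1 hk't (⟨a, ha⟩, m)) (not_le.2 hm)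
  exact closure_minimal hA (isClosed_eq (hX _) (hX _)) hx

/-- The pairing `φ` retracts onto `closure A` and `closure B`; `s` is the retraction of the second
variable. -/
structure IsRetraction {X K : Type*} [TopologicalSpace X] [TopologicalSpace K]
    (φ : X → K → ℝ) (A : Set X) (B : Set K) (s : K → K) : Prop where
  left (x : X) : ∃ x' ∈ closure A, ∀ k ∈ closure B, φ x' k = φ x k
  mem (k : K) : s k ∈ closure B
  eq (k : K) : ∀ x ∈ closure A, φ x (s k) = φ x k

namespace IsRetraction

variable {X K : Type*} [TopologicalSpace X] [TopologicalSpace K] {φ : X → K → ℝ}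
  {A A' : Set X} {B B' : Set K} {s s' : K → K}

theorem apply_eq (h : IsRetraction φ A B s) (x : X) {k : K} (hk : k ∈ closure B) :
    φ x (s k) = φ x k := by
  obtain ⟨x', hx', hxx'⟩ := h.left x
  rw [← hxx' _ (h.mem k), h.eq k x' hx', hxx' k hk]

/-- Retractions onto large subpairs are uniformly close at a given point. -/
theorem exists_finite_close [CompactSpace K]
    (hX : ∀ k, Continuous fun x => φ x k) (hK : ∀ x, Continuous (φ x))
    (h : IsRetraction φ A B s) (x : X) {δ : ℝ} (hδ : 0 < δ) :
    ∃ F : Set X, F.Finite ∧ F ⊆ A ∧ ∀ A' B' s', IsRetraction φ A' B' s' → F ⊆ A' → B' ⊆ B →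
      ∀ k, |φ x (s' k) - φ x (s k)| < δ := by
  obtain ⟨x', hx', hxx'⟩ := h.left x
  -- A point `x'` of `closure A` cannot separate two parameters that all of `A` identifies. By
  -- compactness, finitely many points of `A` detect every pair that `x'` separates by at least `δ`.
  have hP : IsCompact {p : K × K | δ ≤ |φ x' p.1 - φ x' p.2|} :=
    (isClosed_le continuous_const (((hK x').comp continuous_fst).sub
      ((hK x').comp continuous_snd)).abs).isCompact
  obtain ⟨u, hu⟩ := hP.elim_finite_subcover (fun a : A => {p : K × K | φ a p.1 ≠ φ a p.2})
    (fun a => isOpen_ne_fun ((hK a).comp continuous_fst) ((hK a).comp continuous_snd)) (by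
      intro p hp
      by_contra hno
      simp only [mem_iUnion, mem_ofPred_eq, not_exists, not_not] at hno
      have : φ x' p.1 = φ x' p.2 :=
        closure_minimal (fun a ha => hno ⟨a, ha⟩) (isClosed_eq (hX p.1) (hX p.2)) hx'
      rw [mem_ofPred_eq, this, sub_self, abs_zero] at hp
      exact not_lt.2 hp hδ)
  refine ⟨Subtype.val '' (u : Set A), u.finite_toSet.image _, ?_, ?_⟩
  · rintro _ ⟨a, -, rfl⟩
    exact a.2
  · intro A' B' s' h' hF hB k
    rw [← hxx' _ (closure_mono hB (h'.mem k)), ← hxx' _ (h.mem k), h.eq k x' hx']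
    by_contra hno
    obtain ⟨a, ha, hne⟩ := mem_iUnion₂.1
      (hu (show (s' k, k) ∈ {p : K × K | δ ≤ |φ x' p.1 - φ x' p.2|} from not_lt.1 hno))
    exact hne (h'.eq k a (subset_closure (hF ⟨a, ha, rfl⟩)))

end IsRetraction

/-! ### Closing off under countably many finitary operations -/

/-- The closure of `S` under the set-valued operation `op` on finite sets. -/
inductive Generated {Z : Type*} (op : Set Z → Set Z) (S : Set Z) : Z → Prop
  | base (z : Z) (hz : z ∈ S) : Generated op S z
  | step (t : Set Z) (ht : t.Finite) (h : ∀ z ∈ t, Generated op S z) (w : Z) (hw : w ∈ op t) :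
      Generated op S w

namespace Generated

variable {Z : Type*} {op : Set Z → Set Z} {S T : Set Z} {z : Z}

theorem mono (h : S ⊆ T) (hz : Generated op S z) : Generated op T z := by
  induction hz with
  | base z hz => exact .base z (h hz)
  | step t ht _ w hw ih => exact .step t ht ih w hw

/-- A derivation uses only finitely many elements at each step, so directedness lets it be carried
out at one stage. -/
theorem exists_of_iUnion {ι : Type*} [Nonempty ι] {S : ι → Set Z} (hS : Directed (· ⊆ ·) S)
    (hz : Generated op (⋃ i, S i) z) : ∃ i, Generated op (S i) z := by
  induction hz with
  | base z hz =>
    obtain ⟨i, hi⟩ := mem_iUnion.1 hz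
    exact ⟨i, .base z hi⟩
  | step t ht _ w hw ih =>
    choose! f hf using ih
    obtain ⟨i, hi⟩ : ∃ i, ∀ z ∈ t, S (f z) ⊆ S i := by
      obtain ⟨i, hi⟩ := hS.finite_set_le (ht.image f)
      exact ⟨i, fun z hz => hi _ (mem_image_of_mem f hz)⟩
    exact ⟨i, .step t ht (fun z hz => (hf z hz).mono (hi z hz)) w hw⟩

theorem countable (hop : ∀ t : Set Z, t.Finite → (op t).Countable) (hS : S.Countable) :
    {z | Generated op S z}.Countable := by
  let T : ℕ → Set Z := fun n => Nat.rec S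
    (fun _ R => R ∪ ⋃ t ∈ {t : Set Z | t.Finite ∧ t ⊆ R}, op t) n
  have hT : ∀ n, T (n + 1) = T n ∪ ⋃ t ∈ {t : Set Z | t.Finite ∧ t ⊆ T n}, op t := fun n => rfl
  have hmono : Monotone T := monotone_nat_of_le_succ fun n => by
    rw [hT]; exact subset_union_left
  have hc : ∀ n, (T n).Countable := by
    intro n
    induction n with
    | zero => exact hS
    | succ n ih =>
      rw [hT]
      exact ih.union ((countable_ofPred_finite_subset ih).biUnion fun t ht => hop t ht.1)
  suffices h : ∀ z, Generated op S z → z ∈ ⋃ n, T n from (countable_iUnion hc).mono h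
  intro z hz
  induction hz with
  | base z hz => exact mem_iUnion.2 ⟨0, hz⟩
  | step t ht _ w hw ih =>
    simp only [mem_iUnion] at ih
    choose! f hf using ih
    obtain ⟨n, hn⟩ := (ht.image f).bddAbove
    refine mem_iUnion.2 ⟨n + 1, ?_⟩
    rw [hT]
    exact Or.inr (mem_biUnion (x := t)
      ⟨ht, fun z hz => hmono (hn (mem_image_of_mem f hz)) (hf z hz)⟩ hw)

end Generated

/-- For finitely many points there is a countable set of parameters which is dense with respect to
the evaluations at these points. -/
theorem exists_countable_approx {X K : Type*} (φ : X → K → ℝ) {F : Set X} (hF : F.Finite) :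
    ∃ D : Set K, D.Countable ∧ ∀ k, ∀ ε > 0, ∃ b ∈ D, ∀ a ∈ F, |φ a b - φ a k| < ε := by
  have := hF.fintype
  let ev : K → F → ℝ := fun k a => φ a k
  obtain ⟨c, hc, hd⟩ := TopologicalSpace.exists_countable_dense (range ev)
  choose g hg using fun y : range ev => y.2
  refine ⟨g '' c, hc.image g, fun k ε hε => ?_⟩
  obtain ⟨y, hy, hyc⟩ := Metric.dense_iff.1 hd ⟨ev k, k, rfl⟩ ε hε
  refine ⟨g y, ⟨y, hyc, rfl⟩, fun a ha => ?_⟩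
  rw [Metric.mem_ball, Subtype.dist_eq, dist_pi_lt_iff hε] at hy
  have := hy ⟨a, ha⟩
  rw [← hg y] at this
  exact this

/-- There is a countable-valued operation all of whose closed sets give retractions. -/
theorem exists_retraction_op {X K : Type u} [TopologicalSpace X] [TopologicalSpace K]
    [CompactSpace X] [CompactSpace K] {φ : X → K → ℝ} (hX : ∀ k, Continuous fun x => φ x k)
    (hK : ∀ x, Continuous (φ x)) :
    ∃ op : Set (X ⊕ K) → Set (X ⊕ K), (∀ t : Set (X ⊕ K), t.Finite → (op t).Countable) ∧
      ∀ S, ∃ s : K → K, IsRetraction φ {x | Generated op S (.inl x)}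
        {k | Generated op S (.inr k)} s := by
  have h1 : ∀ t : Set (X ⊕ K), ∃ D : Set K, t.Finite → D.Countable ∧
      ∀ k, ∀ ε > 0, ∃ b ∈ D, ∀ a, .inl a ∈ t → |φ a b - φ a k| < ε := by
    intro t
    by_cases ht : t.Finite
    · obtain ⟨D, hD⟩ := exists_countable_approx φ (ht.preimage Sum.inl_injective.injOn)
      exact ⟨D, fun _ => hD⟩
    · exact ⟨∅, fun h => absurd h ht⟩
  have h2 : ∀ t : Set (X ⊕ K), ∃ D : Set X, t.Finite → D.Countable ∧
      ∀ x, ∀ ε > 0, ∃ b ∈ D, ∀ a, .inr a ∈ t → |φ b a - φ x a| < ε := by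
    intro t
    by_cases ht : t.Finite
    · obtain ⟨D, hD⟩ := exists_countable_approx (flip φ) (ht.preimage Sum.inr_injective.injOn)
      exact ⟨D, fun _ => hD⟩
    · exact ⟨∅, fun h => absurd h ht⟩
  choose D hD using h1
  choose E hE using h2
  refine ⟨fun t => .inl '' E t ∪ .inr '' D t,
    fun t ht => ((hE t ht).1.image _).union ((hD t ht).1.image _), fun S => ?_⟩
  set op : Set (X ⊕ K) → Set (X ⊕ K) := fun t => .inl '' E t ∪ .inr '' D t
  have hB : ApproxOn φ {x | Generated op S (.inl x)} {k | Generated op S (.inr k)} := by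
    intro k F hF hFA ε hε
    obtain ⟨b, hb, hbk⟩ := (hD (.inl '' F) (hF.image _)).2 k ε hε
    refine ⟨b, Generated.step (.inl '' F) (hF.image _) ?_ _ (Or.inr ⟨b, hb, rfl⟩),
      fun a ha => hbk a ⟨a, ha, rfl⟩⟩
    rintro _ ⟨a, ha, rfl⟩
    exact hFA ha
  have hA : ApproxOn (flip φ) {k | Generated op S (.inr k)} {x | Generated op S (.inl x)} := by
    intro k F hF hFA ε hε
    obtain ⟨b, hb, hbk⟩ := (hE (.inr '' F) (hF.image _)).2 k ε hε
    refine ⟨b, Generated.step (.inr '' F) (hF.image _) ?_ _ (Or.inl ⟨b, hb, rfl⟩),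
      fun a ha => hbk a ⟨a, ha, rfl⟩⟩
    rintro _ ⟨a, ha, rfl⟩
    exact hFA ha
  choose s hs using hB.exists_eq hX hK
  exact ⟨s, hA.exists_eq hK hX, fun k => (hs k).1, fun k => (hs k).2⟩

/-- Continuity of the retractions along directed unions: the finite set that controls closeness at
`x` is already generated at some stage. -/
theorem Generated.exists_uniform_close {X K : Type u} [TopologicalSpace X] [TopologicalSpace K]
    [CompactSpace K] {φ : X → K → ℝ} (hX : ∀ k, Continuous fun x => φ x k)
    (hK : ∀ x, Continuous (φ x)) {op : Set (X ⊕ K) → Set (X ⊕ K)} {s : Set (X ⊕ K) → K → K}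
    (hs : ∀ S, IsRetraction φ {x | Generated op S (.inl x)} {k | Generated op S (.inr k)} (s S))
    {ι : Type*} [Nonempty ι] {S : ι → Set (X ⊕ K)} (hS : Directed (· ⊆ ·) S) (x : X) {δ : ℝ}
    (hδ : 0 < δ) :
    ∃ i, ∀ T, S i ⊆ T → T ⊆ ⋃ i, S i → ∀ k, |φ x (s T k) - φ x (s (⋃ i, S i) k)| < δ := by
  obtain ⟨F, hF, hFA, h⟩ := (hs (⋃ i, S i)).exists_finite_close hX hK x hδ
  have hFS : ∀ a, a ∈ F → ∃ i, Generated op (S i) (.inl a) :=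
    fun a ha => Generated.exists_of_iUnion hS (hFA ha)
  choose! f hf using hFS
  obtain ⟨i, hi⟩ := hS.finite_set_le (hF.image f)
  exact ⟨i, fun T hiT hT => h _ _ _ (hs T)
    (fun a ha => (hf a ha).mono ((hi _ (mem_image_of_mem f ha)).trans hiT))
    (fun k hk => hk.mono hT)⟩

/-! ### Countable decompositions into pieces of small local diameter -/

/-- For every `ε`, the space is a countable union of pieces which locally have diameter at most `ε`
in the uniform distance over `B`. -/
def HasSmallPieces {X K : Type*} [TopologicalSpace X] (φ : X → K → ℝ) (B : Set K) : Prop :=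
  ∀ ε > 0, ∃ c : X → ℕ, ∀ x, ∃ V ∈ 𝓝 x, ∀ y ∈ V, c y = c x → ∀ b ∈ B, |φ x b - φ y b| ≤ ε

/-- On `B` each `x` acts as a point of `closure A`, hence as a continuous function on the image of
`K` in `ℝ ^ A`. That image is compact metrizable, so these functions lie in a separable Banach
space, and nearest terms of a dense sequence give the pieces. -/
theorem IsRetraction.hasSmallPieces_of_countable {X K : Type*} [TopologicalSpace X]
    [TopologicalSpace K] [CompactSpace K] {φ : X → K → ℝ} (hX : ∀ k, Continuous fun x => φ x k)
    (hK : ∀ x, Continuous (φ x)) {A : Set X} {B : Set K} {s : K → K}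
    (h : IsRetraction φ A B s) (hA : A.Countable) : HasSmallPieces φ B := by
  have := hA.to_subtype
  let ev : K → A → ℝ := fun k a => φ a k
  have hev : Continuous ev := continuous_pi fun a => hK a
  have : CompactSpace (range ev) := isCompact_iff_compactSpace.1 (isCompact_range hev)
  have hq : IsQuotientMap (rangeFactorization ev) :=
    IsQuotientMap.of_surjective_continuous rangeFactorization_surjective
      (hev.subtype_mk _)
  have hg : ∀ x, ∃ g : C(range ev, ℝ), ∀ b ∈ B, g (rangeFactorization ev b) = φ x b := by
    intro x
    obtain ⟨x', hx', hxx'⟩ := h.left x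
    have hfac : ∀ k k', ev k = ev k' → φ x' k = φ x' k' := fun k k' hkk =>
      closure_minimal (fun a ha => congrFun hkk ⟨a, ha⟩) (isClosed_eq (hX k) (hX k')) hx'
    choose r hr using fun y : range ev => y.2
    have heq : ∀ k, φ x' (r (rangeFactorization ev k)) = φ x' k := fun k => hfac _ _ (hr _)
    refine ⟨⟨fun y => φ x' (r y), ?_⟩, fun b hb => ?_⟩
    · rw [hq.continuous_iff]
      exact (hK x').congr fun k => (heq k).symm
    · exact (heq b).trans (hxx' b (subset_closure hb))
  choose g hg using hg
  intro ε hε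
  have hd : ∀ x, ∃ n, dist (TopologicalSpace.denseSeq C(range ev, ℝ) n) (g x) < ε / 2 := fun x => by
    obtain ⟨_, hy, n, rfl⟩ := Metric.dense_iff.1
      (TopologicalSpace.denseRange_denseSeq C(range ev, ℝ)) (g x) (ε / 2) (by positivity)
    exact ⟨n, hy⟩
  choose c hc using hd
  refine ⟨c, fun x => ⟨univ, Filter.univ_mem, fun y _ hxy b hb => ?_⟩⟩
  rw [← hg x b hb, ← hg y b hb, ← Real.dist_eq]
  refine (ContinuousMap.dist_apply_le_dist _).trans ?_
  have h1 := hc x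
  have h2 := hc y
  rw [hxy] at h2
  linarith [dist_triangle_left (g x) (g y) (TopologicalSpace.denseSeq C(range ev, ℝ) (c x))]

/-- Small pieces for the members of a continuous chain yield small pieces for its union. -/
theorem Generated.hasSmallPieces_of_chain {X K : Type u} [TopologicalSpace X] [TopologicalSpace K]
    [CompactSpace K] {φ : X → K → ℝ} (hX : ∀ k, Continuous fun x => φ x k)
    (hK : ∀ x, Continuous (φ x)) {op : Set (X ⊕ K) → Set (X ⊕ K)} {s : Set (X ⊕ K) → K → K}
    (hs : ∀ S, IsRetraction φ {x | Generated op S (.inl x)} {k | Generated op S (.inr k)} (s S))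
    {ι : Type*} [LinearOrder ι] [WellFoundedLT ι] [SuccOrder ι] [NoMaxOrder ι] [Nonempty ι]
    {S : ι → Set (X ⊕ K)} (hS : Monotone S)
    (hlim : ∀ i, Order.IsSuccLimit i → S i = ⋃ j : Iio i, S j)
    (h : ∀ i, HasSmallPieces φ {k | Generated op (S i) (.inr k)}) :
    HasSmallPieces φ {k | Generated op (⋃ i, S i) (.inr k)} := by
  intro ε' hε'
  obtain ⟨ε, hε, rfl⟩ : ∃ ε > 0, ε' = 3 * ε := ⟨ε' / 3, by positivity, by ring⟩
  let f : X → ι → K → ℝ := fun x i k => φ x (s (S i) k)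
  let g : X → K → ℝ := fun x k => φ x (s (⋃ i, S i) k)
  -- The stages at which `x` jumps by more than `1 / (m + 1)`. Infinitely many would contain a
  -- strictly increasing sequence, contradicting uniform convergence along its union.
  let N : ℕ → X → Set ι := fun m x => {j | ∃ k, 1 / ((m : ℝ) + 1) < |f x (Order.succ j) k - f x j k|}
  have hN : ∀ m x, (N m x).Finite := by
    intro m x
    by_contra hinf
    have hinf : (N m x).Infinite := hinf
    let e := hinf.natEmbedding
    obtain ⟨r, hr⟩ := (wellQuasiOrdered_le (α := ι)).exists_monotone_subseq fun n => (e n : ι)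
    let a : ℕ → ι := fun n => e (r n)
    have ha : StrictMono a := Monotone.strictMono_of_injective hr fun m n hmn =>
      r.injective (e.injective (Subtype.ext hmn))
    have hdir : Directed (· ⊆ ·) fun n => S (a n) := (hS.comp ha.monotone).directed_le
    obtain ⟨n, hn⟩ := Generated.exists_uniform_close hX hK hs hdir x
      (δ := 1 / ((m : ℝ) + 1) / 2) (by positivity)
    obtain ⟨k, hk⟩ : a n ∈ N m x := (e (r n)).2
    have h1 := hn (S (a n)) Subset.rfl (subset_iUnion (fun n => S (a n)) n) k
    have h2 := hn (S (Order.succ (a n))) (hS (Order.le_succ _))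
      ((hS (Order.succ_le_of_lt (ha n.lt_succ_self))).trans
        (subset_iUnion (fun n => S (a n)) (n + 1))) k
    simp only [f] at hk
    rw [abs_lt] at h1 h2
    rcases lt_abs.1 hk with hk | hk <;> linarith
  have hi : ∀ x, ∃ i, ∃ δ < ε, ∀ k, |f x i k - g x k| ≤ δ := by
    intro x
    obtain ⟨i, hi⟩ := Generated.exists_uniform_close hX hK hs hS.directed_le x (half_pos hε)
    exact ⟨i, ε / 2, by linarith, fun k => (hi (S i) Subset.rfl (subset_iUnion S i) k).le⟩
  -- `i x` is the first good stage. The strict bound `δ < ε` leaves room to go below a limit stage,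
  -- so `i x` is minimal or a successor; in the latter case `x` jumps at its predecessor.
  have hmin : ∀ x, ∃ i, (∃ δ < ε, ∀ k, |f x i k - g x k| ≤ δ) ∧
      ∀ j < i, ¬ ∃ δ < ε, ∀ k, |f x j k - g x k| ≤ δ := by
    intro x
    obtain ⟨i, hi, hmin⟩ := WellFounded.has_min (wellFounded_lt (α := ι))
      {i | ∃ δ < ε, ∀ k, |f x i k - g x k| ≤ δ} (hi x)
    exact ⟨i, hi, fun j hj hj' => hmin j hj' hj⟩
  choose i hi hmin using hmin
  have hm : ∀ x, ∃ m, ∀ j < i x, ∃ n ∈ N m x, j ≤ n ∧ n < i x := by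
    intro x
    rcases Order.isMin_or_mem_range_succ_or_isSuccLimit (i x) with hx | ⟨j, hj⟩ | hx
    · exact ⟨0, fun j hj => absurd hj hx.not_lt⟩
    · have hlt : j < i x := hj ▸ Order.lt_succ j
      have hne : ∃ k, f x (Order.succ j) k ≠ f x j k := by
        by_contra hno
        push Not at hno
        refine hmin x j hlt ?_
        obtain ⟨δ, hδ, hδk⟩ := hi x
        refine ⟨δ, hδ, fun k => ?_⟩
        rw [← hno k, hj]
        exact hδk k
      obtain ⟨k, hk⟩ := hne
      obtain ⟨m, hm⟩ := exists_nat_one_div_lt (abs_pos.2 (sub_ne_zero.2 hk))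
      refine ⟨m, fun j' hj' => ⟨j, ⟨k, hm⟩, ?_, hlt⟩⟩
      rw [← hj] at hj'
      exact Order.lt_succ_iff.1 hj'
    · exfalso
      obtain ⟨δ, hδ, hδk⟩ := hi x
      obtain ⟨j₀, hj₀⟩ := not_isMin_iff.1 hx.not_isMin
      have : Nonempty (Iio (i x)) := ⟨⟨j₀, hj₀⟩⟩
      have hdir : Directed (· ⊆ ·) fun j : Iio (i x) => S j :=
        (hS.comp (Subtype.mono_coe _)).directed_le
      obtain ⟨j, hj⟩ := Generated.exists_uniform_close hX hK hs hdir x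
        (half_pos (sub_pos.2 hδ))
      rw [← hlim _ hx] at hj
      refine hmin x j j.2 ⟨δ + (ε - δ) / 2, by linarith, fun k => ?_⟩
      have h1 := hj (S j) Subset.rfl (hS (le_of_lt j.2)) k
      exact (abs_sub_le _ (f x (i x) k) _).trans (by linarith [hδk k])
  choose m hm using hm
  choose c hc using fun i => h i ε hε
  -- Near `x` the jumps of `x` persist, so an equal number of jumps forces equal jump sets. The
  -- number of jumps below `i x` then determines `i x`, since jumps are cofinal below it.
  refine ⟨fun x => Encodable.encode (m x, (N (m x) x).ncard, (N (m x) x ∩ Iio (i x)).ncard,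
    c (i x) x), fun x => ?_⟩
  obtain ⟨V, hV, hVc⟩ := hc (i x) x
  refine ⟨V ∩ {y | ∀ n ∈ N (m x) x, n ∈ N (m x) y}, Filter.inter_mem hV ?_, ?_⟩
  · have : {y | ∀ n ∈ N (m x) x, n ∈ N (m x) y} = ⋂ n ∈ N (m x) x, {y | n ∈ N (m x) y} := by
      ext y; simp
    rw [this, Filter.biInter_mem (hN _ _)]
    rintro n ⟨k, hk⟩
    have hopen : IsOpen {y | 1 / ((m x : ℝ) + 1) < |f y (Order.succ n) k - f y n k|} :=
      isOpen_lt continuous_const ((hX _).sub (hX _)).abs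
    exact Filter.mem_of_superset (hopen.mem_nhds hk) fun y hy => ⟨k, hy⟩
  · rintro y ⟨hyV, hyN⟩ hcode b hb
    have hcode := Encodable.encode_injective hcode
    simp only [Prod.mk.injEq] at hcode
    obtain ⟨e1, e2, e3, e4⟩ := hcode
    rw [e1] at e2 e3
    have hmy := hm y
    rw [e1] at hmy
    have hNN : N (m x) x = N (m x) y := eq_of_subset_of_ncard_le hyN e2.le (hN _ _)
    rw [← hNN] at hmy e3
    have hsep : ∀ i j : ι, i < j → (∀ j' < j, ∃ n ∈ N (m x) x, j' ≤ n ∧ n < j) →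
        (N (m x) x ∩ Iio i).ncard < (N (m x) x ∩ Iio j).ncard := by
      intro i j hij hj
      obtain ⟨n, hn, hin, hnj⟩ := hj i hij
      refine ncard_lt_ncard ⟨inter_subset_inter_right _ (Iio_subset_Iio hij.le), fun hsub => ?_⟩
        ((hN _ _).inter_of_left _)
      exact not_lt.2 hin (hsub ⟨hn, hnj⟩).2
    have hii : i y = i x := by
      rcases lt_trichotomy (i y) (i x) with hlt | heq | hlt
      · exact absurd e3 (hsep _ _ hlt (hm x)).ne
      · exact heq
      · exact absurd e3 (hsep _ _ hlt hmy).ne'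
    rw [hii] at e4
    have hsmall := hVc y hyV e4
    have hmid : |f x (i x) b - f y (i x) b| ≤ ε :=
      closure_minimal hsmall (isClosed_le ((hK x).sub (hK y)).abs continuous_const)
        ((hs (S (i x))).mem b)
    obtain ⟨δ, hδ, hδk⟩ := hi x
    obtain ⟨δ', hδ', hδk'⟩ := hi y
    rw [hii] at hδk'
    have h1 := hδk b
    have h2 := hδk' b
    have hgx : g x b = φ x b := (hs _).apply_eq x (subset_closure hb)
    have hgy : g y b = φ y b := (hs _).apply_eq y (subset_closure hb)
    rw [hgx, abs_le] at h1
    rw [hgy, abs_le] at h2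
    rw [abs_le] at hmid ⊢
    constructor <;> linarith

/-- Induction on the cardinality of `S`: an uncountable `S` is the union of a continuous chain of
initial segments of smaller cardinality. -/
theorem Generated.hasSmallPieces {X K : Type u} [TopologicalSpace X] [TopologicalSpace K]
    [CompactSpace K] {φ : X → K → ℝ} (hX : ∀ k, Continuous fun x => φ x k)
    (hK : ∀ x, Continuous (φ x)) {op : Set (X ⊕ K) → Set (X ⊕ K)} {s : Set (X ⊕ K) → K → K}
    (hop : ∀ t : Set (X ⊕ K), t.Finite → (op t).Countable)
    (hs : ∀ S, IsRetraction φ {x | Generated op S (.inl x)} {k | Generated op S (.inr k)} (s S))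
    (S : Set (X ⊕ K)) : HasSmallPieces φ {k | Generated op S (.inr k)} := by
  induction hκ : Cardinal.mk S using WellFoundedLT.induction generalizing S with
  | ind κ ih =>
    by_cases hS : S.Countable
    · exact (hs S).hasSmallPieces_of_countable hX hK
        ((Generated.countable hop hS).preimage Sum.inl_injective)
    have hinf : Cardinal.aleph0 ≤ κ := by
      rw [← hκ]
      exact (not_le.1 fun hle => hS (Cardinal.le_aleph0_iff_set_countable.1 hle)).le
    let ι := κ.ord.ToType
    have hι : Cardinal.mk ι = Cardinal.mk S := by rw [hκ]; exact Cardinal.mk_ord_toType κ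
    obtain ⟨e⟩ := Cardinal.eq.1 hι
    have : NoMaxOrder ι := Cardinal.noMaxOrder hinf
    have : Nonempty ι := by
      rw [← Cardinal.mk_ne_zero_iff, hι, hκ]
      exact (Cardinal.aleph0_pos.trans_le hinf).ne'
    let _ : SuccOrder ι := SuccOrder.ofLinearWellFoundedLT ι
    let T : ι → Set (X ⊕ K) := fun i => (fun j => (e j : X ⊕ K)) '' Iio i
    have hT : ⋃ i, T i = S := by
      ext z
      simp only [mem_iUnion]
      constructor
      · rintro ⟨i, j, -, rfl⟩
        exact (e j).2
      · intro hz
        obtain ⟨i, hi⟩ := exists_gt (e.symm ⟨z, hz⟩)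
        exact ⟨i, e.symm ⟨z, hz⟩, hi, by simp⟩
    rw [← hT]
    refine Generated.hasSmallPieces_of_chain hX hK hs
      (fun i j hij => image_mono (Iio_subset_Iio hij)) (fun i hi => ?_) fun i => ?_
    · refine Subset.antisymm ?_ (iUnion_subset fun j => image_mono (Iio_subset_Iio (le_of_lt j.2)))
      rintro _ ⟨j, hj, rfl⟩
      exact mem_iUnion.2 ⟨⟨Order.succ j, hi.succ_lt hj⟩, j, Order.lt_succ j, rfl⟩
    · refine ih _ ?_ (T i) rfl
      exact Cardinal.mk_image_le.trans_lt (Cardinal.mk_Iio_toType_ord_lt i)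

/-- A compact set of continuous functions on a compact space is, for every `ε`, a countable union
of pieces which in the pointwise topology locally have uniform diameter at most `ε`. -/
theorem hasSmallPieces_univ {X K : Type u} [TopologicalSpace X] [TopologicalSpace K]
    [CompactSpace X] [CompactSpace K] {φ : X → K → ℝ} (hX : ∀ k, Continuous fun x => φ x k)
    (hK : ∀ x, Continuous (φ x)) : HasSmallPieces φ univ := by
  obtain ⟨op, hop, hs⟩ := exists_retraction_op hX hK
  choose s hs using hs
  have := Generated.hasSmallPieces hX hK hop hs univ
  rwa [eq_univ_of_forall fun k => show k ∈ {k | Generated op univ (.inr k)} from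
    .base _ (mem_univ _)] at this

/-! ### Scattered Eberlein compacta -/

/-- A scattered compact set of continuous functions on a compact space is `σ`-discrete. -/
theorem IsEberleinCompact.isSigmaDiscrete {X : Type u} [TopologicalSpace X]
    (hX : IsEberleinCompact X) (hsc : IsScattered X) : IsSigmaDiscrete X := by
  obtain ⟨_, K, _, _, _, e, he⟩ := hX
  let φ : X → K → ℝ := fun x k => (e x).1 k
  have hφX : ∀ k, Continuous fun x => φ x k := fun k =>
    (continuous_apply k).comp (continuous_subtype_val.comp he.continuous)
  have hφK : ∀ x, Continuous (φ x) := fun x => (e x).2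
  obtain ⟨U, hU, hUanti⟩ := hsc.exists_antisymm_nhds
  -- Uniform convergence implies pointwise convergence, so `U x` contains a uniform ball around `x`.
  have hn : ∀ x, ∃ n : ℕ, ∀ y, (∀ k, |φ x k - φ y k| ≤ 1 / ((n : ℝ) + 1)) → y ∈ U x := by
    intro x
    by_contra hno
    push Not at hno
    choose y hy hyU using hno
    have hlim : Filter.Tendsto y Filter.atTop (𝓝 x) := by
      rw [he.tendsto_nhds_iff, tendsto_subtype_rng, tendsto_pi_nhds]
      intro k
      refine tendsto_iff_dist_tendsto_zero.2 (squeeze_zero (fun _ => dist_nonneg) (fun n => ?_)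
        tendsto_one_div_add_atTop_nhds_zero_nat)
      rw [dist_comm]
      exact hy n k
    obtain ⟨n, hn⟩ := (hlim.eventually (hU x)).exists
    exact hyU n hn
  choose n hn using hn
  choose c hc using fun n : ℕ =>
    hasSmallPieces_univ hφX hφK (1 / ((n : ℝ) + 1)) (by positivity)
  -- Nearby points with the same code lie in each other's uniform ball, hence in each other's `U`,
  -- and so coincide.
  refine ⟨fun p => {x | Nat.pair (n x) (c (n x) x) = p}, fun p => ?_,
    eq_univ_of_forall fun x => mem_iUnion.2 ⟨_, rfl⟩⟩
  rw [isDiscrete_iff_forall_mem_exists_isOpen]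
  intro x hx
  obtain ⟨V, hV, hVc⟩ := hc (n x) x
  refine ⟨interior V, isOpen_interior, Subset.antisymm (fun y hy => ?_)
    (singleton_subset_iff.2 ⟨mem_interior_iff_mem_nhds.2 hV, hx⟩)⟩
  obtain ⟨hyV, hyp⟩ := hy
  obtain ⟨h1, h2⟩ := Nat.pair_eq_pair.1 (hyp.trans (Eq.symm hx))
  rw [h1] at h2
  have hsmall := fun k => hVc y (interior_subset hyV) h2 k (mem_univ k)
  exact (hUanti x y (hn y x fun k => by rw [abs_sub_comm, h1]; exact hsmall k)
    (hn x y hsmall)).symm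

theorem corollary4p4 (X : Type u) [TopologicalSpace X]
    (hEG : IsEberleinGrothendieck X) (hC : IsCechComplete X)
    (hI : CoverGame.PlayerIWins (singletons X)) :
    SigmaCompactSpace X ∧ IsSigmaDiscrete X ∧
      ∃ K : ℕ → Set X, ⋃ n, K n = univ ∧
        ∀ n, IsEberleinCompact (K n) ∧ IsScattered (K n) ∧ IsSigmaDiscrete (K n) := by
  choose O hO hOc using hC.exists_isCompact_iInter
  obtain ⟨p, hp⟩ := hI.exists_countable_cover hO
  have hsc := hC.isScattered hI
  let K : ℕ → Set X := fun n => ⋂ k, O (p n) k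
  have hK : ∀ n, IsEberleinCompact (K n) := by
    intro n
    obtain ⟨L, i1, i2, i3, e, he⟩ := hEG
    exact ⟨isCompact_iff_compactSpace.1 (hOc (p n)), L, i1, i2, i3, e ∘ Subtype.val,
      he.comp .subtypeVal⟩
  have hKd : ∀ n, IsSigmaDiscrete (K n) := fun n =>
    (hK n).isSigmaDiscrete (hsc.subtype (K n))
  refine ⟨⟨K, fun n => hOc (p n), hp⟩, ?_, K, hp, fun n => ⟨hK n, hsc.subtype (K n), hKd n⟩⟩
  choose D hD hDu using hKd
  refine ⟨fun m => Subtype.val '' D m.unpair.1 m.unpair.2, fun m => (hD _ _).image .subtypeVal,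
    eq_univ_of_forall fun x => ?_⟩
  obtain ⟨n, hn⟩ := mem_iUnion.1 (hp ▸ mem_univ x : x ∈ ⋃ n, K n)
  obtain ⟨m, hm⟩ := mem_iUnion.1 (hDu n ▸ mem_univ (⟨x, hn⟩ : K n) : _ ∈ ⋃ m, D n m)
  refine mem_iUnion.2 ⟨Nat.pair n m, ?_⟩
  rw [Nat.unpair_pair]
  exact ⟨_, hm, rfl⟩
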